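/- Let $h\in\mathbb R[x_1,\dots,x_n]$ be a homogeneous polynomial, $h\neq 1$, that is hyperbolic in direction $e\in\mathbb R^n$: $h(e)\neq 0$, and for every $a\in\mathbb R^n$ the univariate polynomial $h_{a,e}(t):=h(a-te)$ has only real roots. Let $$\Lambda_e(h)=\{a\in\mathbb R^n\mid h_{a,e}(t)\text{ has only nonnegative roots}\}$$ be its hyperbolicity cone. Let $\mathbb C\langle z_1,\dots,z_n\rangle$ be the free noncommutative algebra with the conjugate-linear involution determined by $z_i^*=z_i$, let $J_e(h)$ be its two-sided ideal generated by the elements $h_{a,e}(a_1z_1+\cdots+a_nz_n)$ for $a\in\mathbb R^n$ and by $1-(e_1z_1+\cdots+e_nz_n)$, and let $\mathcal A_e(h)=\mathbb C\langle z_1,\dots,z_n\rangle/J_e(h)$ be the generalized Clifford algebra, a unital $*$-algebra; denote by $\sigma_i$ the residue class of $z_i$. Let $\Sigma^2\mathcal A_e(h)$ be the set of finite sums $\sum_i b_i^*b_i$ with $b_i\in\mathcal A_e(h)$, let $\overline{\Sigma^2\mathcal A_e(h)}$ be its closure in the finest locally convex topology, and let $\iota\colon\mathbb R^n\to\mathcal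 A_e(h)$ be the linear map $a\mapsto a_1\sigma_1+\cdots+a_n\sigma_n$. Assume that the abstract version of the generalized Lax conjecture holds for $h$ and $e$, that is, $$\Lambda_e(h)=\iota^{-1}\bigl(\overline{\Sigma^2\mathcal A_e(h)}\bigr).$$ Then the generalized Lax conjecture holds for $h$ and $e$: the cone $\Lambda_e(h)$ is spectrahedral, i.e. there are $k$ and hermitian matrices $M_1,\dots,M_n\in\mathbb C^{k\times k}$ with $$\Lambda_e(h)=\{a\in\mathbb R^n\mid a_1M_1+\cdots+a_nM_n\succeq 0\}.$$ If moreover $h$ is irreducible, then there is also a polynomial $f$, hyperbolic in direction $e$, such that $\Lambda_e(fh)=\Lambda_e(h)$ and $fh$ has a definite determinantal representation, i.e. $fh=\det(x_1N_1+\cdots+x_nN_n)$ with hermitian matrices $N_i$ and $e_1N_1+\cdots+e_nN_n$ strictly (positive or negative) definite. -/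

import Mathlib

namespace HyperbolicClifford

noncomputable section

open scoped ComplexOrder

/-! ### Hyperbolic polynomials and spectrahedral cones -/

/-- The univariate polynomial `h_{a,e}(t) = h(a - t • e)`. -/
def restrict {n : ℕ} (h : MvPolynomial (Fin n) ℝ) (e a : Fin n → ℝ) : Polynomial ℝ :=
  MvPolynomial.aeval (fun i => Polynomial.C (a i) - Polynomial.X * Polynomial.C (e i)) h

/-- `h` is homogeneous and hyperbolic in direction `e`: `h(e) ≠ 0` and every complex root of every
`h_{a,e}` is real. -/
structure IsHyperbolic {n : ℕ} (h : MvPolynomial (Fin n) ℝ) (e : Fin n → ℝ) : Prop where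
  homogeneous : ∃ d : ℕ, h.IsHomogeneous d
  eval_ne_zero : MvPolynomial.eval e h ≠ 0
  real_roots : ∀ (a : Fin n → ℝ) (z : ℂ), Polynomial.aeval z (restrict h e a) = 0 → z.im = 0

/-- The hyperbolicity cone `Λ_e(h)`. -/
def hyperbolicityCone {n : ℕ} (h : MvPolynomial (Fin n) ℝ) (e : Fin n → ℝ) : Set (Fin n → ℝ) :=
  {a | ∀ t : ℝ, (restrict h e a).IsRoot t → 0 ≤ t}

/-- The matrix `a • M = a₁ M₁ + ⋯ + aₙ Mₙ`. -/
def pencil {n k : ℕ} (M : Fin n → Matrix (Fin k) (Fin k) ℂ) (a : Fin n → ℝ) :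
    Matrix (Fin k) (Fin k) ℂ :=
  ∑ i, (a i : ℂ) • M i

/-- A linear section of the cone of positive semidefinite hermitian matrices. -/
def IsSpectrahedral {n : ℕ} (K : Set (Fin n → ℝ)) : Prop :=
  ∃ (k : ℕ) (M : Fin n → Matrix (Fin k) (Fin k) ℂ),
    (∀ i, (M i).IsHermitian) ∧ K = {a | (pencil M a).PosSemidef}

/-- `h = det (x₁ M₁ + ⋯ + xₙ Mₙ)` with hermitian `Mᵢ` and `e • M` strictly (positive or negative)
definite. -/
def HasDefiniteDetRep {n : ℕ} (h : MvPolynomial (Fin n) ℝ) (e : Fin n → ℝ) : Prop :=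
  ∃ (k : ℕ) (M : Fin n → Matrix (Fin k) (Fin k) ℂ),
    (∀ i, (M i).IsHermitian) ∧
    MvPolynomial.map (algebraMap ℝ ℂ) h =
      (∑ i, (MvPolynomial.X i : MvPolynomial (Fin n) ℂ) • (M i).map MvPolynomial.C).det ∧
    ((pencil M e).PosDef ∨ (-pencil M e).PosDef)

/-! ### The free `*`-algebra `ℂ⟨z₁, …, zₙ⟩` -/

/-- The free noncommutative algebra `ℂ⟨z₁, …, zₙ⟩`. -/
abbrev NCPoly (n : ℕ) : Type := MonoidAlgebra ℂ (FreeMonoid (Fin n))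

/-- The variable `zᵢ`. -/
def NCPoly.z {n : ℕ} (i : Fin n) : NCPoly n := MonoidAlgebra.single (FreeMonoid.of i) 1

/-- The involution: conjugate the coefficients and reverse the words. -/
def NCPoly.conj {n : ℕ} (p : NCPoly n) : NCPoly n :=
  MonoidAlgebra.map (starRingEnd ℂ : ℂ →+ ℂ)
    (MonoidAlgebra.mapDomain (star : FreeMonoid (Fin n) → FreeMonoid (Fin n)) p)

theorem NCPoly.conj_single {n : ℕ} (w : FreeMonoid (Fin n)) (c : ℂ) :
    NCPoly.conj (MonoidAlgebra.single w c) = MonoidAlgebra.single (star w) (starRingEnd ℂ c) := by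
  simp [NCPoly.conj]

theorem NCPoly.conj_add {n : ℕ} (p q : NCPoly n) :
    NCPoly.conj (p + q) = NCPoly.conj p + NCPoly.conj q := by
  simp [NCPoly.conj, MonoidAlgebra.mapDomain_add, MonoidAlgebra.map_add]

theorem NCPoly.conj_zero {n : ℕ} : NCPoly.conj (0 : NCPoly n) = 0 := by
  simp [NCPoly.conj]

instance (n : ℕ) : StarRing (NCPoly n) where
  star := NCPoly.conj
  star_involutive p := by
    induction p using MonoidAlgebra.induction_linear with
    | zero => simp [NCPoly.conj_zero]
    | add f g hf hg => simp [NCPoly.conj_add, hf, hg]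
    | single w c => simp [NCPoly.conj_single]
  star_mul p q := by
    induction p using MonoidAlgebra.induction_linear with
    | zero => simp [NCPoly.conj_zero]
    | add f g hf hg => simp [NCPoly.conj_add, add_mul, mul_add, hf, hg]
    | single w c =>
      induction q using MonoidAlgebra.induction_linear with
      | zero => simp [NCPoly.conj_zero]
      | add f g hf hg => simp [NCPoly.conj_add, add_mul, mul_add, hf, hg]
      | single v b =>
        simp [NCPoly.conj_single, MonoidAlgebra.single_mul_single, mul_comm]
  star_add := NCPoly.conj_add

theorem NCPoly.star_single {n : ℕ} (w : FreeMonoid (Fin n)) (c : ℂ) :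
    star (MonoidAlgebra.single w c : NCPoly n) =
      MonoidAlgebra.single (star w) (starRingEnd ℂ c) :=
  NCPoly.conj_single w c

theorem NCPoly.star_z {n : ℕ} (i : Fin n) : star (NCPoly.z i) = NCPoly.z i := by
  simp [NCPoly.z, NCPoly.star_single]

instance (n : ℕ) : StarModule ℂ (NCPoly n) where
  star_smul c p := by
    induction p using MonoidAlgebra.induction_linear with
    | zero => simp
    | add f g hf hg => simp [hf, hg]
    | single w b => simp [NCPoly.star_single]

instance (n : ℕ) : StarModule ℝ (NCPoly n) where
  star_smul c p := by
    induction p using MonoidAlgebra.induction_linear with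
    | zero => simp
    | add f g hf hg => simp [hf, hg]
    | single w b => simp [NCPoly.star_single]

/-- The linear form `a • z = a₁ z₁ + ⋯ + aₙ zₙ`. -/
def NCPoly.lin {n : ℕ} (a : Fin n → ℝ) : NCPoly n := ∑ i, a i • NCPoly.z i

theorem NCPoly.star_lin {n : ℕ} (a : Fin n → ℝ) : star (NCPoly.lin a) = NCPoly.lin a := by
  simp [NCPoly.lin, NCPoly.star_z]

theorem NCPoly.star_aeval_lin {n : ℕ} (p : Polynomial ℝ) (a : Fin n → ℝ) :
    star (Polynomial.aeval (NCPoly.lin a) p) = Polynomial.aeval (NCPoly.lin a) p := by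
  rw [Polynomial.aeval_eq_sum_range]
  simp [NCPoly.star_lin]

/-! ### The generalized Clifford algebra -/

/-- The two-sided ideal `J_e(h)` generated by the elements `h_{a,e}(a • z)`, for all `a`, and the
element `1 - e • z`. -/
def cliffordIdeal {n : ℕ} (h : MvPolynomial (Fin n) ℝ) (e : Fin n → ℝ) :
    TwoSidedIdeal (NCPoly n) :=
  TwoSidedIdeal.span
    (Set.range (fun a : Fin n → ℝ => Polynomial.aeval (NCPoly.lin a) (restrict h e a)) ∪
      {1 - NCPoly.lin e})

/-- `J_e(h)` is a `*`-ideal. -/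
theorem star_mem_cliffordIdeal {n : ℕ} (h : MvPolynomial (Fin n) ℝ) (e : Fin n → ℝ)
    {p : NCPoly n} (hp : p ∈ cliffordIdeal h e) : star p ∈ cliffordIdeal h e := by
  let f : NCPoly n →+* ((cliffordIdeal h e).ringCon.Quotient)ᵐᵒᵖ :=
    (RingHom.op (cliffordIdeal h e).ringCon.mk').comp
      (starRingEquiv : NCPoly n ≃+* (NCPoly n)ᵐᵒᵖ).toRingHom
  have hf : ∀ q : NCPoly n, q ∈ TwoSidedIdeal.ker f ↔ star q ∈ cliffordIdeal h e := by
    intro q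
    rw [TwoSidedIdeal.mem_ker, TwoSidedIdeal.mem_iff, ← RingCon.eq]
    exact (MulOpposite.unop_eq_zero_iff (f q)).symm
  have hle : cliffordIdeal h e ≤ TwoSidedIdeal.ker f := by
    refine TwoSidedIdeal.span_le.2 ?_
    rintro q (⟨a, rfl⟩ | rfl)
    · refine (hf _).2 ?_
      rw [NCPoly.star_aeval_lin]
      exact TwoSidedIdeal.subset_span (Or.inl ⟨a, rfl⟩)
    · refine (hf _).2 ?_
      rw [star_sub, star_one, NCPoly.star_lin]
      exact TwoSidedIdeal.subset_span (Or.inr rfl)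
  exact (hf p).1 (hle hp)

/-- The generalized Clifford algebra `𝒜_e(h) = ℂ⟨z₁, …, zₙ⟩ / J_e(h)`. -/
def CliffordAlg {n : ℕ} (h : MvPolynomial (Fin n) ℝ) (e : Fin n → ℝ) : Type :=
  (cliffordIdeal h e).ringCon.Quotient

instance {n : ℕ} (h : MvPolynomial (Fin n) ℝ) (e : Fin n → ℝ) : Ring (CliffordAlg h e) :=
  inferInstanceAs (Ring (cliffordIdeal h e).ringCon.Quotient)

instance {n : ℕ} (h : MvPolynomial (Fin n) ℝ) (e : Fin n → ℝ) : Algebra ℂ (CliffordAlg h e) :=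
  inferInstanceAs (Algebra ℂ (cliffordIdeal h e).ringCon.Quotient)

/-- The residue class map `ℂ⟨z₁, …, zₙ⟩ → 𝒜_e(h)`. -/
def CliffordAlg.mk {n : ℕ} (h : MvPolynomial (Fin n) ℝ) (e : Fin n → ℝ) :
    NCPoly n →ₐ[ℂ] CliffordAlg h e :=
  (cliffordIdeal h e).ringCon.mkₐ (α := ℂ)

theorem CliffordAlg.mk_surjective {n : ℕ} (h : MvPolynomial (Fin n) ℝ) (e : Fin n → ℝ) :
    Function.Surjective (CliffordAlg.mk h e) :=
  RingCon.mkₐ_surjective (α := ℂ) _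

theorem CliffordAlg.mk_eq_mk_iff {n : ℕ} (h : MvPolynomial (Fin n) ℝ) (e : Fin n → ℝ)
    {p q : NCPoly n} :
    CliffordAlg.mk h e p = CliffordAlg.mk h e q ↔ p - q ∈ cliffordIdeal h e := by
  rw [← TwoSidedIdeal.rel_iff]
  exact RingCon.eq _

/-- The involution induced on the quotient. -/
instance {n : ℕ} (h : MvPolynomial (Fin n) ℝ) (e : Fin n → ℝ) : Star (CliffordAlg h e) where
  star := Quotient.map' star fun p q hpq => by
    have hpq' : p - q ∈ cliffordIdeal h e := (TwoSidedIdeal.rel_iff _ _ _).1 hpq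
    refine (TwoSidedIdeal.rel_iff _ _ _).2 ?_
    rw [← star_sub]
    exact star_mem_cliffordIdeal h e hpq'

theorem CliffordAlg.star_mk {n : ℕ} (h : MvPolynomial (Fin n) ℝ) (e : Fin n → ℝ) (p : NCPoly n) :
    star (CliffordAlg.mk h e p) = CliffordAlg.mk h e (star p) :=
  rfl

instance {n : ℕ} (h : MvPolynomial (Fin n) ℝ) (e : Fin n → ℝ) : StarRing (CliffordAlg h e) where
  star_involutive x := by
    obtain ⟨p, rfl⟩ := CliffordAlg.mk_surjective h e x
    rw [CliffordAlg.star_mk, CliffordAlg.star_mk, star_star]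
  star_mul x y := by
    obtain ⟨p, rfl⟩ := CliffordAlg.mk_surjective h e x
    obtain ⟨q, rfl⟩ := CliffordAlg.mk_surjective h e y
    rw [← map_mul, CliffordAlg.star_mk, CliffordAlg.star_mk, CliffordAlg.star_mk, star_mul,
      map_mul]
  star_add x y := by
    obtain ⟨p, rfl⟩ := CliffordAlg.mk_surjective h e x
    obtain ⟨q, rfl⟩ := CliffordAlg.mk_surjective h e y
    rw [← map_add, CliffordAlg.star_mk, CliffordAlg.star_mk, CliffordAlg.star_mk, star_add,
      map_add]

instance {n : ℕ} (h : MvPolynomial (Fin n) ℝ) (e : Fin n → ℝ) : StarModule ℂ (CliffordAlg h e) where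
  star_smul c x := by
    obtain ⟨p, rfl⟩ := CliffordAlg.mk_surjective h e x
    rw [← map_smul, CliffordAlg.star_mk, CliffordAlg.star_mk, star_smul, map_smul]

/-- The residue class `σᵢ` of `zᵢ`. -/
def CliffordAlg.σ {n : ℕ} (h : MvPolynomial (Fin n) ℝ) (e : Fin n → ℝ) (i : Fin n) :
    CliffordAlg h e :=
  CliffordAlg.mk h e (NCPoly.z i)

/-- The linear map `ι : ℝⁿ → 𝒜_e(h)`, `a ↦ a • σ = a₁ σ₁ + ⋯ + aₙ σₙ`. -/
def CliffordAlg.ι {n : ℕ} (h : MvPolynomial (Fin n) ℝ) (e : Fin n → ℝ) :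
    (Fin n → ℝ) →ₗ[ℝ] CliffordAlg h e where
  toFun a := ∑ i, a i • CliffordAlg.σ h e i
  map_add' a b := by simp [add_smul, Finset.sum_add_distrib]
  map_smul' c a := by simp [mul_smul, Finset.smul_sum]

/-- The cone `Σ²A` of sums of hermitian squares of a `*`-ring. -/
def sumsOfHermitianSquares (A : Type*) [Semiring A] [StarRing A] : Set A :=
  {x | ∃ (m : ℕ) (b : Fin m → A), x = ∑ i, star (b i) * b i}

/-- The finest locally convex vector space topology on a real vector space. -/
abbrev finestLocallyConvex (V : Type*) [AddCommGroup V] [Module ℝ V] : TopologicalSpace V :=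
  sInf {t : TopologicalSpace V | @IsTopologicalAddGroup V t _ ∧ @ContinuousSMul ℝ V _ _ t ∧
    @LocallyConvexSpace ℝ V _ _ _ _ t}

theorem finestLocallyConvex_mem (V : Type*) [AddCommGroup V] [Module ℝ V] :
    @IsTopologicalAddGroup V (finestLocallyConvex V) _ ∧
      @ContinuousSMul ℝ V _ _ (finestLocallyConvex V) ∧
      @LocallyConvexSpace ℝ V _ _ _ _ (finestLocallyConvex V) :=
  ⟨topologicalAddGroup_sInf fun _ ht => ht.1, continuousSMul_sInf fun _ ht => ht.2.1,
    LocallyConvexSpace.sInf fun _ ht => ht.2.2⟩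

/-- The closed sums of squares cone of `𝒜_e(h)`. -/
def closedSOSCone {n : ℕ} (h : MvPolynomial (Fin n) ℝ) (e : Fin n → ℝ) : Set (CliffordAlg h e) :=
  @closure _ (finestLocallyConvex (CliffordAlg h e)) (sumsOfHermitianSquares (CliffordAlg h e))

/-! ### The two conjectures, for a given `h` and `e` -/

/-- `Λ_e(h) = ι⁻¹(closure of Σ²𝒜_e(h))`. -/
def AbstractLax {n : ℕ} (h : MvPolynomial (Fin n) ℝ) (e : Fin n → ℝ) : Prop :=
  hyperbolicityCone h e = CliffordAlg.ι h e ⁻¹' closedSOSCone h e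

/-- Some multiple `f * h` of `h`, with `f` hyperbolic and the same hyperbolicity cone as `h`, has a
definite determinantal representation. -/
def HasDefiniteDetRepMultiple {n : ℕ} (h : MvPolynomial (Fin n) ℝ) (e : Fin n → ℝ) : Prop :=
  ∃ f : MvPolynomial (Fin n) ℝ, IsHyperbolic f e ∧
    hyperbolicityCone (f * h) e = hyperbolicityCone h e ∧ HasDefiniteDetRep (f * h) e

end

end HyperbolicClifford

/-! Positive functionals on `𝒜_e(h)` are turned into finite symmetric matrices, and factorization of
polynomials reduces the many matrices so obtained to one.

If `a₀` lies outside the cone, the abstract conjecture and Hahn-Banach give a positive functional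
`φ` with `φ(ι a₀) < 0`. Its GNS representation may be infinite-dimensional, so it is compressed to
the span of products of `deg h` linear forms in the `σᵢ` (`IsPositive.exists_compression`). The
result is a real symmetric family `L` with `L e = 1`, positive semidefinite on the cone. The
truncation is long enough for `h_{a,e}(ι a) = 0` to give `h_{a,e}(L a) ξ = 0` for the cyclic vector
`ξ`. Near `a₀` also `⟨ξ, L a ξ⟩ = φ(ι a) < 0`, so some negative eigenvalue of `L a` is a root of
`h_{a,e}`.

Hence `h` and `det L` share a root on every line in direction `e` through points near `a₀`. By
Gauss's lemma, on a generic line such a root comes from a common irreducible factor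
(`exists_generic_common_factor`). Up to units `h` has finitely many irreducible factors, so one
direct sum collects every factor that any relaxation can contribute (`exists_universal_relaxation`).
This single family cuts out the cone exactly. If `h` is irreducible, the factor is `h` itself, and
the cofactor of `h` in the determinant is the required `f`. -/

namespace HyperbolicClifford

open Polynomial Matrix
open scoped ComplexOrder

/-! ### Positive functionals on real `*`-algebras -/

/-- A finite-dimensional space with a positive semidefinite symmetric form has a finite
orthonormal system that is complete up to null vectors. -/
theorem exists_orthonormal_system {V : Type*} [AddCommGroup V] [Module ℝ V] [Module.Finite ℝ V]
    (B : V →ₗ[ℝ] V →ₗ[ℝ] ℝ) (hsymm : ∀ x y, B x y = B y x) (hpos : ∀ x, 0 ≤ B x x) :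
    ∃ (k : ℕ) (v : Fin k → V), (∀ i j, B (v i) (v j) = if i = j then 1 else 0) ∧
      ∀ p, B (p - ∑ i, B (v i) p • v i) (p - ∑ i, B (v i) p • v i) = 0 := by
  let core : PreInnerProductSpace.Core ℝ V :=
    { inner := fun x y => B x y
      conj_inner_symm := fun x y => by simpa using hsymm y x
      re_inner_nonneg := fun x => by simpa using hpos x
      add_left := fun x y z => by simp
      smul_left := fun x y r => by simp }
  let : SeminormedAddCommGroup V := InnerProductSpace.Core.toSeminormedAddCommGroup (c := core)
  let : InnerProductSpace ℝ V := InnerProductSpace.ofCore core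
  have hB : ∀ x y : V, inner ℝ x y = B x y := fun _ _ => rfl
  let π := SeparationQuotient.mkCLM ℝ V
  have hπ : ∀ x y, inner ℝ (π x) (π y) = B x y := fun x y => SeparationQuotient.inner_mk_mk x y
  have hsurj : Function.Surjective π := SeparationQuotient.surjective_mk
  have : Module.Finite ℝ (SeparationQuotient V) :=
    Module.Finite.of_surjective π.toLinearMap hsurj
  let b := stdOrthonormalBasis ℝ (SeparationQuotient V)
  choose v hv using fun i => hsurj (b i)
  refine ⟨_, v, fun i j => ?_, fun p => ?_⟩
  · rw [← hπ, hv, hv]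
    exact orthonormal_iff_ite.1 b.orthonormal i j
  · have h0 : π (p - ∑ i, B (v i) p • v i) = 0 := by
      rw [map_sub, map_sum, sub_eq_zero]
      conv_lhs => rw [← b.sum_repr' (π p)]
      refine Finset.sum_congr rfl fun i _ => ?_
      rw [map_smul, hv, ← hv i, hπ]
    rw [← hπ, h0, inner_zero_left]

section Positive

variable {A : Type*} [Ring A] [Algebra ℝ A] [StarRing A]

/-- A linear functional that is invariant under the involution and nonnegative on hermitian
squares. -/
structure IsPositive (φ : A →ₗ[ℝ] ℝ) : Prop where
  map_star : ∀ x, φ (star x) = φ x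
  nonneg : ∀ x, 0 ≤ φ (star x * x)

variable [StarModule ℝ A] {φ : A →ₗ[ℝ] ℝ}

/-- The symmetric form `(x, y) ↦ φ (x* y)`. -/
noncomputable def gnsForm (φ : A →ₗ[ℝ] ℝ) : A →ₗ[ℝ] A →ₗ[ℝ] ℝ :=
  LinearMap.mk₂ ℝ (fun x y => φ (star x * y)) (by simp [add_mul]) (by simp) (by simp [mul_add])
    (by simp)

theorem gnsForm_apply (x y : A) : gnsForm φ x y = φ (star x * y) := rfl

theorem IsPositive.gnsForm_symm (hφ : IsPositive φ) (x y : A) :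
    gnsForm φ x y = gnsForm φ y x := by
  rw [gnsForm_apply, gnsForm_apply, ← hφ.map_star, star_mul, star_star]

/-- The degenerate case of Cauchy-Schwarz: as `r` is null, `φ` on the hermitian square of `x* + t r`
is affine in `t`. Being nonnegative for all real `t`, it has slope zero. -/
theorem IsPositive.gnsForm_eq_zero (hφ : IsPositive φ) {r : A} (hr : φ (star r * r) = 0) (x : A) :
    φ (x * r) = 0 := by
  by_contra hne
  have key : ∀ t : ℝ, 0 ≤ φ (x * star x) + 2 * t * φ (x * r) := by
    intro t
    have h := hφ.nonneg (star x + t • r)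
    have h2 : φ (star r * star x) = φ (x * r) := by
      rw [← hφ.map_star, star_mul, star_star, star_star]
    simp only [star_add, star_star, star_smul, star_trivial, add_mul, mul_add, map_add,
      smul_mul_assoc, mul_smul_comm, map_smul, smul_eq_mul, h2, hr] at h
    linarith
  -- At this `t` the affine function takes the value `-1`.
  have := key (-(φ (x * star x) + 1) / (2 * φ (x * r)))
  have h2 : 2 * (-(φ (x * star x) + 1) / (2 * φ (x * r))) * φ (x * r) =
    -(φ (x * star x) + 1) := by field_simp
  rw [h2] at this
  linarith

end Positive

/-! ### Symmetric matrices and their real eigenvalues -/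

/-- Phrasing eigenvalues as zeros of `det (A - t)` matches the definition of `hyperbolicityCone`;
general `𝕜` allows the passage from real to complex matrices. -/
theorem isHermitian_eigenvalue_nonneg_iff {m 𝕜 : Type*} [Fintype m] [DecidableEq m] [RCLike 𝕜]
    {A : Matrix m m 𝕜} (hA : A.IsHermitian) :
    A.PosSemidef ↔ ∀ t : ℝ, (A - (t : 𝕜) • (1 : Matrix m m 𝕜)).det = 0 → 0 ≤ t := by
  constructor
  · intro h t ht
    obtain ⟨v, hv0, hv⟩ := Matrix.exists_mulVec_eq_zero_iff.2 ht
    rw [sub_mulVec, smul_mulVec, one_mulVec, sub_eq_zero] at hv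
    have h1 := h.dotProduct_mulVec_nonneg v
    rw [hv, dotProduct_smul, smul_eq_mul] at h1
    have h2 : (0 : 𝕜) < star v ⬝ᵥ v := dotProduct_star_self_pos_iff.2 hv0
    by_contra! h3
    have h4 : (t : 𝕜) < 0 := by exact_mod_cast h3
    exact (mul_neg_of_neg_of_pos h4 h2).not_ge h1
  · intro h
    rw [hA.posSemidef_iff_eigenvalues_nonneg]
    intro i
    refine h _ (Matrix.exists_mulVec_eq_zero_iff.1 ⟨(hA.eigenvectorBasis i).ofLp, ?_, ?_⟩)
    · intro h0
      apply hA.eigenvectorBasis.orthonormal.ne_zero i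
      ext j
      exact congrFun h0 j
    · rw [sub_mulVec, smul_mulVec, one_mulVec, hA.mulVec_eigenvectorBasis, sub_eq_zero]
      ext j
      simp [RCLike.real_smul_eq_coe_mul]

/-- If `p(A)ξ = 0` and `⟨Aξ, ξ⟩ < 0`, then `p` has a negative root that is an eigenvalue of `A`. -/
theorem exists_neg_root_of_aeval_mulVec_eq_zero {m : Type*} [Fintype m] [DecidableEq m]
    {A : Matrix m m ℝ} (hA : A.IsHermitian) (p : ℝ[X]) (ξ : m → ℝ)
    (hp : (aeval A p) *ᵥ ξ = 0) (hneg : ξ ⬝ᵥ A *ᵥ ξ < 0) :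
    ∃ t < 0, p.IsRoot t ∧ (A - t • (1 : Matrix m m ℝ)).det = 0 := by
  let u : m → m → ℝ := fun i => (hA.eigenvectorBasis i).ofLp
  have hu : ∀ i, A *ᵥ u i = hA.eigenvalues i • u i := hA.mulVec_eigenvectorBasis
  have hsymm : ∀ x y : m → ℝ, x ⬝ᵥ A *ᵥ y = (A *ᵥ x) ⬝ᵥ y := by
    intro x y
    have hT : Aᵀ = A := by simpa [conjTranspose_eq_transpose_of_trivial] using hA.eq
    rw [dotProduct_mulVec, ← mulVec_transpose, hT]
  have hpow : ∀ i (q : ℝ[X]) (y : m → ℝ),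
      u i ⬝ᵥ (aeval A q) *ᵥ y = q.eval (hA.eigenvalues i) * (u i ⬝ᵥ y) := by
    intro i q
    induction q using Polynomial.induction_on' with
    | add p q hp hq => intro y; simp [add_mulVec, hp, hq, add_mul]
    | monomial n a =>
      intro y
      rw [aeval_monomial, eval_monomial, ← Algebra.smul_def, smul_mulVec, dotProduct_smul,
        smul_eq_mul, mul_assoc]
      congr 1
      induction n generalizing y with
      | zero => simp
      | succ n ih =>
        rw [pow_succ, ← mulVec_mulVec, ih, hsymm, hu, smul_dotProduct, smul_eq_mul]
        ring
  have hsum : ∀ x y : m → ℝ, x ⬝ᵥ y = ∑ i, (u i ⬝ᵥ x) * (u i ⬝ᵥ y) := by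
    intro x y
    have := hA.eigenvectorBasis.sum_inner_mul_inner (WithLp.toLp 2 x) (WithLp.toLp 2 y)
    simp only [EuclideanSpace.inner_eq_star_dotProduct, star_trivial] at this
    rw [dotProduct_comm, ← this]
    refine Finset.sum_congr rfl fun i _ => ?_
    rw [dotProduct_comm y]
  -- In the eigenbasis `⟨ξ, Aξ⟩` is the sum of these terms, so one is negative. For its index,
  -- `p(λᵢ)⟨uᵢ, ξ⟩ = 0` with `⟨uᵢ, ξ⟩ ≠ 0`.
  have hex : ∃ i, hA.eigenvalues i * (u i ⬝ᵥ ξ) ^ 2 < 0 := by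
    by_contra! hall
    refine hneg.not_ge ?_
    rw [hsum]
    refine Finset.sum_nonneg fun i _ => ?_
    have := hpow i X ξ
    rw [aeval_X, eval_X] at this
    rw [this]
    linarith [hall i]
  obtain ⟨i, hi⟩ := hex
  have hξ : u i ⬝ᵥ ξ ≠ 0 := by
    intro h0
    simp [h0] at hi
  refine ⟨hA.eigenvalues i, ?_, ?_, ?_⟩
  · by_contra! h0
    exact hi.not_ge (mul_nonneg h0 (sq_nonneg _))
  · have := hpow i p ξ
    rw [hp, dotProduct_zero] at this
    exact (mul_eq_zero.1 this.symm).resolve_right hξ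
  · refine Matrix.exists_mulVec_eq_zero_iff.1 ⟨u i, ?_, ?_⟩
    · intro h0
      simp [h0] at hξ
    · rw [sub_mulVec, smul_mulVec, one_mulVec, hu, sub_self]

/-! ### Positive functionals on the generalized Clifford algebra -/

/-- The topology induced by `f` is itself a locally convex vector space topology, so the finest one
refines it. -/
theorem continuous_finestLocallyConvex {V : Type*} [AddCommGroup V] [Module ℝ V]
    (f : V →ₗ[ℝ] ℝ) : @Continuous V ℝ (finestLocallyConvex V) _ f := by
  rw [continuous_iff_le_induced]
  exact sInf_le ⟨topologicalAddGroup_induced f, continuousSMul_induced f,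
    LocallyConvexSpace.induced f⟩

theorem nonneg_of_mem_closure_finestLocallyConvex {V : Type*} [AddCommGroup V] [Module ℝ V]
    {s : Set V} (f : V →ₗ[ℝ] ℝ) (hf : ∀ x ∈ s, 0 ≤ f x) {x : V}
    (hx : x ∈ @closure V (finestLocallyConvex V) s) : 0 ≤ f x := by
  let := finestLocallyConvex V
  have hc : IsClosed (f ⁻¹' Set.Ici 0) := isClosed_Ici.preimage (continuous_finestLocallyConvex f)
  exact closure_minimal (fun y hy => hf y hy) hc hx

/-! ### The cone of sums of hermitian squares and its separation -/

section SumsOfSquares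

variable {A : Type*} [Ring A] [StarRing A]

theorem zero_mem_sumsOfHermitianSquares : (0 : A) ∈ sumsOfHermitianSquares A :=
  ⟨0, Fin.elim0, by simp⟩

theorem star_mul_self_mem_sumsOfHermitianSquares (b : A) :
    star b * b ∈ sumsOfHermitianSquares A :=
  ⟨1, fun _ => b, by simp⟩

theorem add_mem_sumsOfHermitianSquares {x y : A} (hx : x ∈ sumsOfHermitianSquares A)
    (hy : y ∈ sumsOfHermitianSquares A) : x + y ∈ sumsOfHermitianSquares A := by
  obtain ⟨k, b, rfl⟩ := hx
  obtain ⟨l, c, rfl⟩ := hy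
  exact ⟨k + l, Fin.append b c, by simp [Fin.sum_univ_add]⟩

theorem smul_mem_sumsOfHermitianSquares [Algebra ℝ A] [StarModule ℝ A] {x : A} {r : ℝ}
    (hr : 0 ≤ r) (hx : x ∈ sumsOfHermitianSquares A) : r • x ∈ sumsOfHermitianSquares A := by
  obtain ⟨k, b, rfl⟩ := hx
  refine ⟨k, fun i => √r • b i, ?_⟩
  simp [Finset.smul_sum, smul_smul, Real.mul_self_sqrt hr]

/-- Separation of a self-adjoint element from the closed cone of sums of hermitian squares. -/
theorem exists_isPositive_neg [Algebra ℝ A] [StarModule ℝ A] {x : A} (hstar : star x = x)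
    (hx : x ∉ @closure A (finestLocallyConvex A) (sumsOfHermitianSquares A)) :
    ∃ φ : A →ₗ[ℝ] ℝ, IsPositive φ ∧ φ x < 0 := by
  let := finestLocallyConvex A
  have hfin := finestLocallyConvex_mem A
  have := hfin.1
  have := hfin.2.1
  have := hfin.2.2
  have hconv : Convex ℝ (sumsOfHermitianSquares A) := fun x hx y hy a b ha hb _ =>
    add_mem_sumsOfHermitianSquares (smul_mem_sumsOfHermitianSquares ha hx)
      (smul_mem_sumsOfHermitianSquares hb hy)
  obtain ⟨f, u, hfx, hfu⟩ := geometric_hahn_banach_point_closed hconv.closure isClosed_closure hx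
  have hu : u < 0 := by
    simpa using hfu 0 (subset_closure zero_mem_sumsOfHermitianSquares)
  have hf : ∀ b : A, 0 ≤ f (star b * b) := by
    intro b
    by_contra! hb
    -- Rescaling a square with `f (b* b) < 0` by `u / f (b* b) ≥ 0` attains the value `u`, which `f`
    -- must strictly exceed on the cone.
    have hmem := smul_mem_sumsOfHermitianSquares (div_nonneg_of_nonpos hu.le hb.le)
      (star_mul_self_mem_sumsOfHermitianSquares b)
    have := hfu _ (subset_closure hmem)
    rw [map_smul, smul_eq_mul, div_mul_cancel₀ _ hb.ne] at this
    exact this.false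
  -- Symmetrizing makes the functional `*`-invariant; at the self-adjoint `x` it only doubles the
  -- value.
  refine ⟨f.toLinearMap + f.toLinearMap ∘ₗ (starLinearEquiv ℝ (A := A)).toLinearMap,
    ⟨fun y => ?_, fun y => ?_⟩, ?_⟩
  · simp [add_comm]
  · simpa using add_nonneg (hf y) (hf y)
  · simpa [hstar] using by linarith

/-- `y ↦ φ(p* y p)` is again nonnegative on squares, and linear functionals are continuous. This
makes the compressed matrices semidefinite on the cone. -/
theorem IsPositive.nonneg_conj_of_mem_closure [Algebra ℝ A] [StarModule ℝ A] {φ : A →ₗ[ℝ] ℝ}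
    (hφ : IsPositive φ) {x : A}
    (hx : x ∈ @closure A (finestLocallyConvex A) (sumsOfHermitianSquares A)) (p : A) :
    0 ≤ φ (star p * x * p) := by
  let g : A →ₗ[ℝ] ℝ := φ ∘ₗ LinearMap.mulRight ℝ p ∘ₗ LinearMap.mulLeft ℝ (star p)
  refine nonneg_of_mem_closure_finestLocallyConvex g ?_ hx
  rintro _ ⟨k, b, rfl⟩
  rw [map_sum]
  refine Finset.sum_nonneg fun i _ => ?_
  have := hφ.nonneg (b i * p)
  simpa [g, mul_assoc] using this

end SumsOfSquares

/-! ### Truncated GNS construction -/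

section Compression

variable {A : Type*} [Ring A] [Algebra ℝ A] [StarRing A] [StarModule ℝ A]

/-- Truncated GNS construction: a positive functional `φ` on `A` compresses a linear family
`ι : E → A` of self-adjoint elements to symmetric matrices of finite size, in such a way that the
functional calculus up to degree `d` on the cyclic vector is preserved. -/
theorem IsPositive.exists_compression {E : Type*} [AddCommGroup E] [Module ℝ E]
    [Module.Finite ℝ E] {φ : A →ₗ[ℝ] ℝ} (hφ : IsPositive φ) (ι : E →ₗ[ℝ] A)
    (hι : ∀ a, star (ι a) = ι a) {e : E} (he : ι e = 1) (d : ℕ) :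
    ∃ (k : ℕ) (L : E →ₗ[ℝ] Matrix (Fin k) (Fin k) ℝ), (∀ a, (L a).IsHermitian) ∧ L e = 1 ∧
      (∀ a, (∀ p, 0 ≤ φ (star p * ι a * p)) → (L a).PosSemidef) ∧
      ∀ a, φ (ι a) < 0 → ∀ p : ℝ[X], p.natDegree ≤ d → aeval (ι a) p = 0 →
        ∃ t < 0, p.IsRoot t ∧ (L a - t • (1 : Matrix (Fin k) (Fin k) ℝ)).det = 0 := by
  -- Products of exactly `d` elements suffice: since `ι e = 1`, padding with `ι e` gives all lower
  -- powers.
  let V : Submodule ℝ A := ι.range ^ d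
  have hpow : ∀ a, ∀ j ≤ d, ι a ^ j ∈ V := by
    intro a j hj
    have h1 : ι a ^ j * ι e ^ (d - j) ∈ V := by
      change _ ∈ ι.range ^ d
      rw [← Nat.add_sub_cancel' hj, pow_add, Nat.add_sub_cancel_left]
      exact Submodule.mul_mem_mul (Submodule.pow_mem_pow _ (LinearMap.mem_range_self ι a) _)
        (Submodule.pow_mem_pow _ (LinearMap.mem_range_self ι e) _)
    simpa [he] using h1
  have hfin : Module.Finite ℝ V := Module.Finite.iff_fg.2 ((Module.Finite.iff_fg.1 (Module.Finite.range ι)).pow d)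
  obtain ⟨k, v, hv, hc⟩ := exists_orthonormal_system
    ((gnsForm φ).compl₁₂ V.subtype V.subtype) (fun x y => hφ.gnsForm_symm _ _)
    (fun x => hφ.nonneg _)
  simp only [LinearMap.compl₁₂_apply, Submodule.subtype_apply, gnsForm_apply] at hv hc
  -- `p` differs from its projection onto the `vᵢ` by a null vector, which `φ(x ·)` kills for every
  -- `x` in `A`, not only in `V`.
  have hexp : ∀ x : A, ∀ p ∈ V, φ (x * p) = ∑ i, φ (x * v i) * φ (star (v i : A) * p) := by
    intro x p hp
    have := hφ.gnsForm_eq_zero (hc ⟨p, hp⟩) x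
    rw [AddSubgroupClass.coe_sub, mul_sub, map_sub, sub_eq_zero] at this
    rw [this]
    simp [Finset.mul_sum, mul_comm]
  let L : E →ₗ[ℝ] Matrix (Fin k) (Fin k) ℝ :=
    { toFun := fun a => Matrix.of fun i j => φ (star (v i : A) * ι a * v j)
      map_add' := fun a b => by ext i j; simp [mul_add, add_mul]
      map_smul' := fun c a => by ext i j; simp }
  have hL : ∀ a i j, L a i j = φ (star (v i : A) * ι a * v j) := fun _ _ _ => rfl
  have hH : ∀ a, (L a).IsHermitian := by
    intro a
    ext i j
    rw [conjTranspose_apply, star_trivial, hL, hL, ← hφ.map_star]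
    simp [hι, mul_assoc]
  refine ⟨k, L, hH, ?_, ?_, ?_⟩
  · ext i j
    rw [hL, he, mul_one, hv, Matrix.one_apply]
  · intro a ha
    refine PosSemidef.of_dotProduct_mulVec_nonneg (hH a) fun x => ?_
    have h1 := ha (∑ i, x i • (v i : A))
    simp only [star_sum, star_smul, star_trivial, Finset.sum_mul, Finset.mul_sum, map_sum,
      smul_mul_assoc, mul_smul_comm, map_smul, smul_eq_mul] at h1
    simp only [dotProduct, mulVec, star_trivial, hL, Finset.mul_sum]
    rw [Finset.sum_comm]
    refine h1.trans_eq (Finset.sum_congr rfl fun i _ => Finset.sum_congr rfl fun j _ => ?_)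
    ring
  · intro a ha p hpd hp
    let c : A → Fin k → ℝ := fun x i => φ (star (v i : A) * x)
    -- `c` gives coordinates of the projection to `V`, so `ι a * x` may leave `V`. This is why
    -- powers up to `d` itself are preserved on `c 1`.
    have hcL : ∀ x ∈ V, L a *ᵥ c x = c (ι a * x) := by
      intro x hx
      ext i
      simp only [mulVec, dotProduct, hL, c]
      rw [← mul_assoc, hexp _ x hx]
    have hcpow : ∀ j ≤ d, (L a ^ j) *ᵥ c 1 = c (ι a ^ j) := by
      intro j
      induction j with
      | zero => simp
      | succ j ih =>
        intro hj
        rw [pow_succ', ← mulVec_mulVec, ih (by omega), hcL _ (hpow a j (by omega)), pow_succ']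
    have h1 : (1 : A) ∈ V := by simpa using hpow a 0 (Nat.zero_le d)
    refine exists_neg_root_of_aeval_mulVec_eq_zero (hH a) p (c 1) ?_ ?_
    · have h2 : c (aeval (ι a) p) = 0 := by
        ext i
        simp [c, hp]
      rw [← h2, aeval_eq_sum_range, aeval_eq_sum_range]
      ext i
      rw [sum_mulVec, Finset.sum_apply]
      simp only [c, Finset.mul_sum, map_sum]
      refine Finset.sum_congr rfl fun j hj => ?_
      rw [smul_mulVec, hcpow j (by rw [Finset.mem_range] at hj; omega)]
      simp [c]
    · refine lt_of_eq_of_lt ?_ ha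
      rw [hcL 1 h1, mul_one, dotProduct]
      have h3 := hexp (ι a) 1 h1
      rw [mul_one] at h3
      rw [h3]
      refine Finset.sum_congr rfl fun i _ => ?_
      rw [mul_comm, ← hφ.map_star (ι a * v i), star_mul, hι]

end Compression

/-! ### Relations in the generalized Clifford algebra -/

variable {n : ℕ} (h : MvPolynomial (Fin n) ℝ) (e : Fin n → ℝ)

theorem CliffordAlg.ι_eq_mk_lin (a : Fin n → ℝ) :
    CliffordAlg.ι h e a = CliffordAlg.mk h e (NCPoly.lin a) := by
  change ∑ i, a i • CliffordAlg.σ h e i = _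
  rw [NCPoly.lin, map_sum]
  exact Finset.sum_congr rfl fun i _ =>
    (map_smul ((CliffordAlg.mk h e).restrictScalars ℝ) (a i) _).symm

theorem CliffordAlg.star_ι (a : Fin n → ℝ) :
    star (CliffordAlg.ι h e a) = CliffordAlg.ι h e a := by
  rw [CliffordAlg.ι_eq_mk_lin, CliffordAlg.star_mk, NCPoly.star_lin]

theorem CliffordAlg.ι_direction : CliffordAlg.ι h e e = 1 := by
  rw [CliffordAlg.ι_eq_mk_lin, ← map_one (CliffordAlg.mk h e), eq_comm,
    CliffordAlg.mk_eq_mk_iff]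
  exact TwoSidedIdeal.subset_span (Or.inr rfl)

theorem CliffordAlg.aeval_ι (a : Fin n → ℝ) :
    aeval (CliffordAlg.ι h e a) (restrict h e a) = 0 := by
  have h1 : CliffordAlg.mk h e (aeval (NCPoly.lin a) (restrict h e a)) = CliffordAlg.mk h e 0 := by
    rw [CliffordAlg.mk_eq_mk_iff, sub_zero]
    exact TwoSidedIdeal.subset_span (Or.inl ⟨a, rfl⟩)
  rw [CliffordAlg.ι_eq_mk_lin, ← map_zero (CliffordAlg.mk h e), ← h1]
  exact aeval_algHom_apply ((CliffordAlg.mk h e).restrictScalars ℝ) _ _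

/-! ### Common roots along lines -/

/-- Gauss's lemma: an irreducible polynomial over a GCD domain is coprime, up to a nonzero constant,
to every polynomial that it does not divide. -/
theorem exists_bezout_of_irreducible_of_not_dvd {R : Type*} [CommRing R] [IsDomain R]
    [IsGCDMonoid R] {p q : R[X]} (hp : Irreducible p) (hpq : ¬ p ∣ q) :
    ∃ r : R, r ≠ 0 ∧ ∃ u v : R[X], u * p + v * q = C r := by
  by_cases hdeg : p.natDegree = 0
  · obtain ⟨r, rfl⟩ := natDegree_eq_zero.1 hdeg
    exact ⟨r, fun h => hp.ne_zero (by simp [h]), 1, 0, by simp⟩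
  have hprim := hp.isPrimitive hdeg
  let K := FractionRing R
  have hirr := (hprim.irreducible_iff_irreducible_map_fraction_map (K := K)).1 hp
  have hndvd := mt (hprim.dvd_iff_fraction_map_dvd_fraction_map K).2 hpq
  obtain ⟨u, v, huv⟩ := (EuclideanDomain.dvd_or_coprime _ (map (algebraMap R K) q) hirr).resolve_left
    hndvd
  obtain ⟨b, hb, hbu⟩ := IsLocalization.integerNormalization_spec (nonZeroDivisors R) u
  obtain ⟨c, hc, hcv⟩ := IsLocalization.integerNormalization_spec (nonZeroDivisors R) v
  refine ⟨b * c, mul_ne_zero (nonZeroDivisors.ne_zero hb) (nonZeroDivisors.ne_zero hc),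
    C c * IsLocalization.integerNormalization (nonZeroDivisors R) u,
    C b * IsLocalization.integerNormalization (nonZeroDivisors R) v, ?_⟩
  refine map_injective (algebraMap R K) (IsFractionRing.injective R K) ?_
  rw [Polynomial.map_add, Polynomial.map_mul, Polynomial.map_mul, Polynomial.map_mul,
    Polynomial.map_mul, hbu, hcv, map_C, map_C, map_C, Algebra.smul_def, Algebra.smul_def,
    Polynomial.algebraMap_apply, Polynomial.algebraMap_apply, map_mul (algebraMap R K), C_mul]
  linear_combination (C (algebraMap R K b) * C (algebraMap R K c)) * huv

section Lines

variable {n : ℕ}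

/-- The polynomial `h(x - t e)` in `t` with coefficients in `ℝ[x]`. -/
noncomputable def lineExpansion (e : Fin n → ℝ) :
    MvPolynomial (Fin n) ℝ →ₐ[ℝ] (MvPolynomial (Fin n) ℝ)[X] :=
  MvPolynomial.aeval fun i => C (MvPolynomial.X i) - X * C (MvPolynomial.C (e i))

theorem lineExpansion_C (e : Fin n → ℝ) (r : ℝ) :
    lineExpansion e (MvPolynomial.C r) = C (MvPolynomial.C r) := by
  simp [lineExpansion, Polynomial.algebraMap_apply]

theorem lineExpansion_X (e : Fin n → ℝ) (i : Fin n) :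
    lineExpansion e (MvPolynomial.X i) =
      C (MvPolynomial.X i) - X * C (MvPolynomial.C (e i)) := by
  simp [lineExpansion]

/-- The substitution `x ↦ x - t e` of `ℝ[x][t]`. -/
noncomputable def lineShift (e : Fin n → ℝ) :
    (MvPolynomial (Fin n) ℝ)[X] →+* (MvPolynomial (Fin n) ℝ)[X] :=
  eval₂RingHom (lineExpansion e).toRingHom X

theorem lineShift_C (e : Fin n → ℝ) (q : MvPolynomial (Fin n) ℝ) :
    lineShift e (C q) = lineExpansion e q := by
  simp [lineShift]

theorem lineShift_X (e : Fin n → ℝ) : lineShift e X = X := by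
  simp [lineShift]

theorem lineShift_lineExpansion (e e' : Fin n → ℝ) (he : e + e' = 0)
    (q : MvPolynomial (Fin n) ℝ) : lineShift e (lineExpansion e' q) = C q := by
  have he' : ∀ i, e' i = -e i := fun i => by
    have := congrFun he i
    simp only [Pi.add_apply, Pi.zero_apply] at this
    linarith
  induction q using MvPolynomial.induction_on with
  | C a => rw [lineExpansion_C, lineShift_C, lineExpansion_C]
  | add p q hp hq => simp [hp, hq]
  | mul_X p i hp =>
    rw [map_mul, map_mul, hp, lineExpansion_X, map_sub, map_mul, lineShift_C, lineShift_C,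
      lineShift_X, lineExpansion_X, lineExpansion_C, he', C_mul, MvPolynomial.C_neg, C_neg]
    ring

theorem lineShift_lineShift (e e' : Fin n → ℝ) (he : e + e' = 0) (p : (MvPolynomial (Fin n) ℝ)[X]) :
    lineShift e (lineShift e' p) = p := by
  induction p using Polynomial.induction_on' with
  | add p q hp hq => simp [hp, hq]
  | monomial k a =>
    rw [← C_mul_X_pow_eq_monomial, map_mul, map_mul, map_pow, map_pow, lineShift_X, lineShift_X,
      lineShift_C, lineShift_lineExpansion e e' he]

/-- `lineShift` as an automorphism. -/
noncomputable def lineShiftEquiv (e : Fin n → ℝ) :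
    (MvPolynomial (Fin n) ℝ)[X] ≃+* (MvPolynomial (Fin n) ℝ)[X] :=
  RingEquiv.ofRingHom (lineShift e) (lineShift (-e))
    (RingHom.ext (lineShift_lineShift _ _ (by simp)))
    (RingHom.ext (lineShift_lineShift _ _ (by simp)))

/-- The expansion of `q` is the image of the constant `C q` under an automorphism of `ℝ[x][t]`, and
constants inherit primality. -/
theorem irreducible_lineExpansion (e : Fin n → ℝ) {q : MvPolynomial (Fin n) ℝ} (hq : Prime q) :
    Irreducible (lineExpansion e q) := by
  rw [← lineShift_C]
  exact (MulEquiv.irreducible_iff (lineShiftEquiv e)).2 (prime_C_iff.2 hq).irreducible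

theorem lineExpansion_dvd_iff (e : Fin n → ℝ) {q g : MvPolynomial (Fin n) ℝ} :
    lineExpansion e q ∣ lineExpansion e g ↔ q ∣ g := by
  refine ⟨fun hd => ?_, map_dvd _⟩
  have := map_dvd (lineShift (-e)) hd
  rw [lineShift_lineExpansion _ _ (by simp), lineShift_lineExpansion _ _ (by simp),
    C_dvd_iff_dvd_coeff] at this
  simpa using this 0

theorem map_lineExpansion (e a : Fin n → ℝ) (q : MvPolynomial (Fin n) ℝ) :
    (lineExpansion e q).map (MvPolynomial.eval a) = restrict q e a := by
  induction q using MvPolynomial.induction_on with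
  | C r => simp [lineExpansion, restrict, Polynomial.algebraMap_apply]
  | add p q hp hq => rw [map_add, Polynomial.map_add, hp, hq]; simp [restrict]
  | mul_X p i hp =>
    rw [map_mul, Polynomial.map_mul, hp]
    simp [lineExpansion, restrict]

theorem eval_restrict (h : MvPolynomial (Fin n) ℝ) (e a : Fin n → ℝ) (t : ℝ) :
    (restrict h e a).eval t = MvPolynomial.eval (a - t • e) h := by
  induction h using MvPolynomial.induction_on with
  | C r => simp [restrict]
  | add p q hp hq => simp only [restrict, map_add, eval_add] at *; rw [hp, hq]
  | mul_X p i hp => simp only [restrict, map_mul, eval_mul] at *; rw [hp]; simp [mul_comm t]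

theorem isRoot_restrict_iff {h : MvPolynomial (Fin n) ℝ} {e a : Fin n → ℝ} {t : ℝ} :
    (restrict h e a).IsRoot t ↔ MvPolynomial.eval (a - t • e) h = 0 := by
  rw [IsRoot.def, eval_restrict]

theorem natDegree_restrict_le (h : MvPolynomial (Fin n) ℝ) (e a : Fin n → ℝ) :
    (restrict h e a).natDegree ≤ h.totalDegree := by
  have := MvPolynomial.aeval_natDegree_le (n := 1) h le_rfl
    (fun i => C (a i) - X * C (e i)) fun i => ?_
  · rwa [mul_one] at this
  · compute_degree

/-- If a prime `q` does not divide `g`, then generic lines in direction `e` meet no common zero of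
`q` and `g`. -/
theorem exists_ne_zero_of_prime_of_not_dvd (e : Fin n → ℝ) {q g : MvPolynomial (Fin n) ℝ}
    (hq : Prime q) (hqg : ¬ q ∣ g) :
    ∃ r : MvPolynomial (Fin n) ℝ, r ≠ 0 ∧ ∀ (a : Fin n → ℝ) (t : ℝ),
      (restrict q e a).IsRoot t → (restrict g e a).IsRoot t → MvPolynomial.eval a r = 0 := by
  obtain ⟨r, hr, u, v, huv⟩ := exists_bezout_of_irreducible_of_not_dvd
    (irreducible_lineExpansion e hq) (mt (lineExpansion_dvd_iff e).1 hqg)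
  refine ⟨r, hr, fun a t h1 h2 => ?_⟩
  have h3 := congrArg (fun p => (p.map (MvPolynomial.eval a)).eval t) huv
  simp only [Polynomial.map_add, Polynomial.map_mul, map_lineExpansion, eval_add, eval_mul,
    h1.eq_zero, h2.eq_zero, map_C, eval_C, mul_zero, add_zero] at h3
  exact h3.symm

/-- On a generic line in direction `e`, every common zero of `h` and `g` is a zero of a common
irreducible factor. -/
theorem exists_generic_common_factor (e : Fin n → ℝ) (h g : MvPolynomial (Fin n) ℝ) (hh : h ≠ 0) :
    ∃ r : MvPolynomial (Fin n) ℝ, r ≠ 0 ∧ ∀ (a : Fin n → ℝ) (t : ℝ), MvPolynomial.eval a r ≠ 0 →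
      (restrict h e a).IsRoot t → (restrict g e a).IsRoot t →
        ∃ q, Irreducible q ∧ q ∣ h ∧ q ∣ g ∧ (restrict q e a).IsRoot t := by
  induction h using UniqueFactorizationMonoid.induction_on_prime with
  | h₁ => exact absurd rfl hh
  | h₂ u hu =>
    refine ⟨1, one_ne_zero, fun a t _ ht => ?_⟩
    have : IsUnit (MvPolynomial.eval (a - t • e) u) := hu.map _
    exact absurd (isRoot_restrict_iff.1 ht) this.ne_zero
  | h₃ h q hh0 hq ih =>
    obtain ⟨r, hr, hr'⟩ := ih hh0
    have hsplit : ∀ {a : Fin n → ℝ} {t : ℝ}, (restrict (q * h) e a).IsRoot t →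
        (restrict q e a).IsRoot t ∨ (restrict h e a).IsRoot t := by
      intro a t ht
      simpa only [isRoot_restrict_iff, map_mul, mul_eq_zero] using ht
    by_cases hqg : q ∣ g
    · refine ⟨r, hr, fun a t hra h1 h2 => ?_⟩
      rcases hsplit h1 with h1 | h1
      · exact ⟨q, hq.irreducible, dvd_mul_right _ _, hqg, h1⟩
      · obtain ⟨q', hq', hd, hd', hrt⟩ := hr' a t hra h1 h2
        exact ⟨q', hq', hd.mul_left _, hd', hrt⟩
    · obtain ⟨s, hs, hs'⟩ := exists_ne_zero_of_prime_of_not_dvd e hq hqg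
      refine ⟨s * r, mul_ne_zero hs hr, fun a t hra h1 h2 => ?_⟩
      rw [map_mul, mul_ne_zero_iff] at hra
      rcases hsplit h1 with h1 | h1
      · exact absurd (hs' a t h1 h2) hra.1
      · obtain ⟨q', hq', hd, hd', hrt⟩ := hr' a t hra.2 h1 h2
        exact ⟨q', hq', hd.mul_left _, hd', hrt⟩

/-- A nonzero polynomial cannot vanish on a product of open intervals, so generic points exist in
every neighbourhood. -/
theorem exists_eval_ne_zero_of_eventually {r : MvPolynomial (Fin n) ℝ} (hr : r ≠ 0)
    {a₀ : Fin n → ℝ} {P : (Fin n → ℝ) → Prop} (hP : ∀ᶠ a in nhds a₀, P a) :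
    ∃ a, P a ∧ MvPolynomial.eval a r ≠ 0 := by
  obtain ⟨ε, hε, hball⟩ := Metric.eventually_nhds_iff_ball.1 hP
  by_contra! hall
  refine hr (MvPolynomial.funext_set (fun i => Metric.ball (a₀ i) ε) (fun i => ?_) fun x hx => ?_)
  · rw [Real.ball_eq_Ioo]
    exact Set.Ioo_infinite (by linarith)
  · rw [map_zero]
    refine hall x (hball x ?_)
    rw [ball_pi _ hε]
    exact hx

end Lines

/-! ### Spectrahedral relaxations -/

section Relaxation

variable {n : ℕ}

/-- A symmetric linear matrix family that is the identity in direction `e` and positive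
semidefinite on `K`. -/
structure IsRelaxation (K : Set (Fin n → ℝ)) (e : Fin n → ℝ) {m : Type*} [Fintype m]
    [DecidableEq m] (L : (Fin n → ℝ) →ₗ[ℝ] Matrix m m ℝ) : Prop where
  isHermitian : ∀ a, (L a).IsHermitian
  map_direction : L e = 1
  posSemidef : ∀ a ∈ K, (L a).PosSemidef

/-- The determinant `det (x₁ L₁ + ⋯ + xₙ Lₙ)` of a linear matrix family. -/
noncomputable def detPoly {m : Type*} [Fintype m] [DecidableEq m]
    (L : (Fin n → ℝ) →ₗ[ℝ] Matrix m m ℝ) : MvPolynomial (Fin n) ℝ :=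
  (∑ i, (MvPolynomial.X i : MvPolynomial (Fin n) ℝ) •
    (L (Pi.single i 1)).map MvPolynomial.C).det

theorem linear_eq_sum {W : Type*} [AddCommGroup W] [Module ℝ W] (L : (Fin n → ℝ) →ₗ[ℝ] W)
    (a : Fin n → ℝ) : L a = ∑ i, a i • L (Pi.single i 1) := by
  conv_lhs => rw [pi_eq_sum_univ' a, map_sum]
  refine Finset.sum_congr rfl fun i _ => ?_
  rw [map_smul]

section

variable {m : Type*} [Fintype m] [DecidableEq m] (L : (Fin n → ℝ) →ₗ[ℝ] Matrix m m ℝ)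

theorem eval_detPoly (a : Fin n → ℝ) : MvPolynomial.eval a (detPoly L) = (L a).det := by
  rw [detPoly, RingHom.map_det]
  congr 1
  conv_rhs => rw [linear_eq_sum L a]
  ext i j
  simp [Matrix.sum_apply]

theorem isHomogeneous_detPoly : (detPoly L).IsHomogeneous (Fintype.card m) := by
  rw [detPoly, det_apply]
  refine MvPolynomial.IsHomogeneous.sum _ _ _ fun σ _ => ?_
  rw [Units.smul_def, zsmul_eq_mul, ← map_intCast (MvPolynomial.C : ℝ →+* _)]
  refine MvPolynomial.IsHomogeneous.C_mul ?_ _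
  have := MvPolynomial.IsHomogeneous.prod Finset.univ (fun i =>
    (∑ j, (MvPolynomial.X j : MvPolynomial (Fin n) ℝ) •
      (L (Pi.single j 1)).map (MvPolynomial.C (σ := Fin n))) (σ i) i) (fun _ => 1) fun i _ => ?_
  · simpa using this
  · rw [Matrix.sum_apply]
    refine MvPolynomial.IsHomogeneous.sum _ _ _ fun j _ => ?_
    rw [Matrix.smul_apply, smul_eq_mul, map_apply, mul_comm]
    exact MvPolynomial.isHomogeneous_C_mul_X _ _

variable {L} {K : Set (Fin n → ℝ)} {e : Fin n → ℝ}

/-- Because `L e = 1`, moving along direction `e` is shifting the spectrum. -/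
theorem IsRelaxation.isRoot_iff (hL : IsRelaxation K e L) {a : Fin n → ℝ} {t : ℝ} :
    (restrict (detPoly L) e a).IsRoot t ↔ (L a - t • (1 : Matrix m m ℝ)).det = 0 := by
  rw [isRoot_restrict_iff, eval_detPoly, map_sub, map_smul, hL.map_direction]

theorem IsRelaxation.hyperbolicityCone_eq (hL : IsRelaxation K e L) :
    hyperbolicityCone (detPoly L) e = {a | (L a).PosSemidef} := by
  ext a
  rw [Set.mem_ofPred_eq, isHermitian_eigenvalue_nonneg_iff (hL.isHermitian a)]
  exact forall_congr' fun t => imp_congr_left hL.isRoot_iff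

end

/-- The direct sum of two linear matrix families. -/
def directSum {m m' : Type*} (L : (Fin n → ℝ) →ₗ[ℝ] Matrix m m ℝ)
    (L' : (Fin n → ℝ) →ₗ[ℝ] Matrix m' m' ℝ) :
    (Fin n → ℝ) →ₗ[ℝ] Matrix (m ⊕ m') (m ⊕ m') ℝ where
  toFun a := fromBlocks (L a) 0 0 (L' a)
  map_add' a b := by simp [fromBlocks_add]
  map_smul' c a := by simp [fromBlocks_smul]

/-- Relabelling of rows and columns of a linear matrix family. -/
def relabel {m m' : Type*} (σ : m ≃ m') (L : (Fin n → ℝ) →ₗ[ℝ] Matrix m m ℝ) :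
    (Fin n → ℝ) →ₗ[ℝ] Matrix m' m' ℝ :=
  (reindexLinearEquiv ℝ ℝ σ σ).toLinearMap ∘ₗ L

section

variable {K : Set (Fin n → ℝ)} {e : Fin n → ℝ} {m m' : Type*} [Fintype m] [DecidableEq m]
  [Fintype m'] [DecidableEq m'] {L : (Fin n → ℝ) →ₗ[ℝ] Matrix m m ℝ}
  {L' : (Fin n → ℝ) →ₗ[ℝ] Matrix m' m' ℝ}

theorem IsRelaxation.directSum (hL : IsRelaxation K e L) (hL' : IsRelaxation K e L') :
    IsRelaxation K e (directSum L L') := by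
  have hH : ∀ a, (HyperbolicClifford.directSum L L' a).IsHermitian := fun a =>
    (hL.isHermitian a).fromBlocks (by simp) (hL'.isHermitian a)
  refine ⟨hH, ?_, fun a ha => ?_⟩
  · change fromBlocks (L e) 0 0 (L' e) = 1
    rw [hL.map_direction, hL'.map_direction, fromBlocks_one]
  · rw [isHermitian_eigenvalue_nonneg_iff (hH a)]
    intro t ht
    have h1 : HyperbolicClifford.directSum L L' a - t • (1 : Matrix (m ⊕ m') (m ⊕ m') ℝ) =
        fromBlocks (L a - t • (1 : Matrix m m ℝ)) 0 0 (L' a - t • (1 : Matrix m' m' ℝ)) := by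
      rw [← fromBlocks_one, fromBlocks_smul]
      simp [HyperbolicClifford.directSum, sub_eq_add_neg, fromBlocks_neg, fromBlocks_add]
    simp only [RCLike.ofReal_real_eq_id, id_eq] at ht
    rw [h1, det_fromBlocks_zero₂₁, mul_eq_zero] at ht
    rcases ht with h2 | h2
    · exact (isHermitian_eigenvalue_nonneg_iff (hL.isHermitian a)).1 (hL.posSemidef a ha) t h2
    · exact (isHermitian_eigenvalue_nonneg_iff (hL'.isHermitian a)).1 (hL'.posSemidef a ha) t h2

theorem detPoly_directSum : detPoly (directSum L L') = detPoly L * detPoly L' := by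
  refine MvPolynomial.funext fun a => ?_
  rw [map_mul, eval_detPoly, eval_detPoly, eval_detPoly]
  exact det_fromBlocks_zero₂₁ _ _ _

theorem IsRelaxation.relabel (hL : IsRelaxation K e L) (σ : m ≃ m') :
    IsRelaxation K e (relabel σ L) :=
  ⟨fun a => (hL.isHermitian a).submatrix _, by
    simp [HyperbolicClifford.relabel, hL.map_direction],
    fun a ha => (hL.posSemidef a ha).submatrix _⟩

theorem detPoly_relabel (σ : m ≃ m') : detPoly (relabel σ L) = detPoly L := by
  refine MvPolynomial.funext fun a => ?_
  rw [eval_detPoly, eval_detPoly]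
  exact det_submatrix_equiv_self _ _

end

/-- Among finitely many primes, one relaxation collects all those dividing the determinant of some
relaxation. -/
theorem exists_universal_relaxation (K : Set (Fin n → ℝ)) (e : Fin n → ℝ)
    {g : MvPolynomial (Fin n) ℝ} (hg : g ≠ 0) :
    ∃ (k : ℕ) (L : (Fin n → ℝ) →ₗ[ℝ] Matrix (Fin k) (Fin k) ℝ), IsRelaxation K e L ∧
      ∀ q, Irreducible q → q ∣ g → ∀ (k' : ℕ) (L' : (Fin n → ℝ) →ₗ[ℝ] Matrix (Fin k') (Fin k') ℝ),
        IsRelaxation K e L' → q ∣ detPoly L' → q ∣ detPoly L := by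
  induction g using UniqueFactorizationMonoid.induction_on_prime with
  | h₁ => exact absurd rfl hg
  | h₂ u hu =>
    refine ⟨0, 0, ⟨fun a => Subsingleton.elim _ _, Subsingleton.elim _ _, fun a _ => ?_⟩,
      fun q hq hqu => absurd (isUnit_of_dvd_unit hqu hu) hq.not_isUnit⟩
    exact PosSemidef.zero
  | h₃ g p hg0 hp ih =>
    obtain ⟨k, L, hL, hLq⟩ := ih hg0
    -- Either some relaxation realizes `p` and is added as a direct summand, or `p` never occurs and
    -- needs no attention.
    by_cases hex : ∃ (k' : ℕ) (L' : (Fin n → ℝ) →ₗ[ℝ] Matrix (Fin k') (Fin k') ℝ),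
        IsRelaxation K e L' ∧ p ∣ detPoly L'
    · obtain ⟨l, M, hM, hpM⟩ := hex
      refine ⟨k + l, relabel finSumFinEquiv (directSum L M), (hL.directSum hM).relabel _,
        fun q hq hqg k' L' hL' hqL' => ?_⟩
      rw [detPoly_relabel, detPoly_directSum]
      rcases hq.prime.dvd_or_dvd hqg with h1 | h1
      · exact (h1.trans hpM).mul_left _
      · exact (hLq q hq h1 k' L' hL' hqL').mul_right _
    · refine ⟨k, L, hL, fun q hq hqg k' L' hL' hqL' => ?_⟩
      rcases hq.prime.dvd_or_dvd hqg with h1 | h1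
      · exact absurd ⟨k', L', hL', (hq.dvd_symm hp.irreducible h1).trans hqL'⟩ hex
      · exact hLq q hq h1 k' L' hL' hqL'

/-- Positive definiteness is an open condition on a linear matrix family. -/
theorem eventually_posDef {m : Type*} [Fintype m] [DecidableEq m]
    {L : (Fin n → ℝ) →ₗ[ℝ] Matrix m m ℝ} (hL : ∀ a, (L a).IsHermitian) {a₀ : Fin n → ℝ}
    (h : (L a₀).PosDef) : ∀ᶠ a in nhds a₀, (L a).PosDef := by
  have hcont : Continuous fun z : (Fin n → ℝ) × (m → ℝ) => z.2 ⬝ᵥ L z.1 *ᵥ z.2 := by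
    have hentry : ∀ i j, Continuous fun a => L a i j := fun i j =>
      ((Matrix.entryLinearMap ℝ ℝ i j) ∘ₗ L).continuous_of_finiteDimensional
    simp only [dotProduct, mulVec]
    refine continuous_finsetSum _ fun i _ => Continuous.mul (by fun_prop) ?_
    refine continuous_finsetSum _ fun j _ => Continuous.mul ?_ (by fun_prop)
    exact (hentry i j).comp continuous_fst
  -- Compactness of the unit sphere makes the neighbourhood of `a₀` uniform in `x`; homogeneity then
  -- covers all nonzero `x`.
  have hev := (isCompact_sphere (0 : m → ℝ) 1).eventually_forall_of_forall_eventually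
    (x₀ := a₀) (P := fun a x => 0 < x ⬝ᵥ L a *ᵥ x) fun x hx => by
      refine hcont.continuousAt.eventually_const_lt ?_
      have hx0 : x ≠ 0 := by
        rintro rfl
        simp at hx
      simpa using h.dotProduct_mulVec_pos hx0
  filter_upwards [hev] with a ha
  refine PosDef.of_dotProduct_mulVec_pos (hL a) fun x hx => ?_
  have hn : 0 < ‖x‖ := norm_pos_iff.2 hx
  have h1 := ha (‖x‖⁻¹ • x) (by simp [norm_smul, hn.ne'])
  rw [mulVec_smul, smul_dotProduct, dotProduct_smul, smul_smul, smul_eq_mul] at h1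
  rw [star_trivial]
  exact (pos_iff_pos_of_mul_pos h1).1 (by positivity)

end Relaxation

/-! ### From the abstract to the concrete conjecture -/

section Main

variable {n : ℕ} {h : MvPolynomial (Fin n) ℝ} {e : Fin n → ℝ}

/-- One `L` serves a whole neighbourhood of `a₀`, because `φ ∘ ι` is continuous and stays negative
there. This leaves room to move to a generic point. -/
theorem AbstractLax.exists_relaxation (conj : AbstractLax h e) {a₀ : Fin n → ℝ}
    (ha₀ : a₀ ∉ hyperbolicityCone h e) :
    ∃ (k : ℕ) (L : (Fin n → ℝ) →ₗ[ℝ] Matrix (Fin k) (Fin k) ℝ),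
      IsRelaxation (hyperbolicityCone h e) e L ∧
      ∀ᶠ a in nhds a₀, ∃ t < 0, (restrict h e a).IsRoot t ∧
        (restrict (detPoly L) e a).IsRoot t := by
  have hmem : ∀ a, a ∈ hyperbolicityCone h e ↔ CliffordAlg.ι h e a ∈ closedSOSCone h e := by
    intro a
    conv_lhs => rw [conj]
    rfl
  rw [hmem] at ha₀
  obtain ⟨φ, hφ, hneg⟩ := exists_isPositive_neg (CliffordAlg.star_ι h e a₀) ha₀
  obtain ⟨k, L, hH, he, hpos, hroot⟩ := hφ.exists_compression (CliffordAlg.ι h e)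
    (CliffordAlg.star_ι h e) (CliffordAlg.ι_direction h e) h.totalDegree
  have hL : IsRelaxation (hyperbolicityCone h e) e L :=
    ⟨hH, he, fun a ha => hpos a (hφ.nonneg_conj_of_mem_closure ((hmem a).1 ha))⟩
  refine ⟨k, L, hL, ?_⟩
  have hcont : Continuous (φ ∘ₗ CliffordAlg.ι h e) := LinearMap.continuous_of_finiteDimensional _
  filter_upwards [hcont.continuousAt.eventually_lt_const hneg] with a ha
  obtain ⟨t, ht, h1, h2⟩ := hroot a ha (restrict h e a) (natDegree_restrict_le h e a)
    (CliffordAlg.aeval_ι h e a)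
  exact ⟨t, ht, h1, hL.isRoot_iff.2 h2⟩

/-- If the abstract conjecture holds, then the hyperbolicity cone is defined by a single linear
matrix family, which may be chosen so that every irreducible factor of `h` dividing the determinant
of some relaxation divides its determinant. -/
theorem AbstractLax.exists_exact_relaxation (conj : AbstractLax h e) (hh : h ≠ 0) :
    ∃ (k : ℕ) (L : (Fin n → ℝ) →ₗ[ℝ] Matrix (Fin k) (Fin k) ℝ),
      IsRelaxation (hyperbolicityCone h e) e L ∧
      hyperbolicityCone h e = {a | (L a).PosSemidef} ∧
      ∀ q, Irreducible q → q ∣ h → ∀ (k' : ℕ) (L' : (Fin n → ℝ) →ₗ[ℝ] Matrix (Fin k') (Fin k') ℝ),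
        IsRelaxation (hyperbolicityCone h e) e L' → q ∣ detPoly L' → q ∣ detPoly L := by
  obtain ⟨k, L, hL, hLq⟩ := exists_universal_relaxation (hyperbolicityCone h e) e hh
  refine ⟨k, L, hL, Set.Subset.antisymm hL.posSemidef fun a ha => ?_, hLq⟩
  by_contra hna
  obtain ⟨t, ht, ht0⟩ : ∃ t, (restrict h e a).IsRoot t ∧ t < 0 := by
    simpa [hyperbolicityCone] using hna
  -- Moving by `-t/2 > 0` along `e` halves the negative root `t`, so the point stays outside the
  -- cone while `L` becomes positive definite, an open condition.
  have hna' : a + (-t / 2) • e ∉ hyperbolicityCone h e := by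
    intro hmem
    have := hmem (t / 2) ?_
    · linarith
    rw [isRoot_restrict_iff] at ht ⊢
    rwa [show a + (-t / 2) • e - (t / 2) • e = a - t • e by module]
  have hpd : (L (a + (-t / 2) • e)).PosDef := by
    rw [map_add, map_smul, hL.map_direction]
    exact PosDef.posSemidef_add ha (PosDef.one.smul (by linarith))
  obtain ⟨k', L', hL', hev⟩ := conj.exists_relaxation hna'
  obtain ⟨r, hr, hgen⟩ := exists_generic_common_factor e h (detPoly L') hh
  obtain ⟨b, ⟨⟨s, hs, hs1, hs2⟩, hb⟩, hbr⟩ :=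
    exists_eval_ne_zero_of_eventually hr (hev.and (eventually_posDef hL.isHermitian hpd))
  obtain ⟨q, hq, hqh, hqL', hqs⟩ := hgen b s hbr hs1 hs2
  -- Universality passes `q` from `det L'` to `det L`, so `s < 0` becomes an eigenvalue of the
  -- positive definite `L b`.
  obtain ⟨g, hg⟩ := hLq q hq hqh k' L' hL' hqL'
  have hroot : (restrict (detPoly L) e b).IsRoot s := by
    rw [isRoot_restrict_iff] at hqs ⊢
    rw [hg, map_mul, hqs, zero_mul]
  exact hs.not_ge ((isHermitian_eigenvalue_nonneg_iff hb.isHermitian).1 hb.posSemidef s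
    (hL.isRoot_iff.1 hroot))

/-! ### Irreducible hyperbolic polynomials -/

theorem IsHyperbolic.eval_zero_of_irreducible (hyp : IsHyperbolic h e) (hirr : Irreducible h) :
    MvPolynomial.eval 0 h = 0 := by
  obtain ⟨d, hd⟩ := hyp.homogeneous
  by_contra h0
  rw [MvPolynomial.eval_zero, MvPolynomial.constantCoeff_eq] at h0
  have hd0 : d = 0 := by
    by_contra hd0
    exact h0 (hd.coeff_eq_zero (d := 0) (by simpa using Ne.symm hd0))
  rw [hd0, ← MvPolynomial.totalDegree_zero_iff_isHomogeneous,
    MvPolynomial.totalDegree_eq_zero_iff_eq_C] at hd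
  refine hirr.not_isUnit ?_
  rw [hd]
  exact (IsUnit.mk0 _ h0).map MvPolynomial.C

theorem IsHyperbolic.neg_notMem_of_irreducible (hyp : IsHyperbolic h e) (hirr : Irreducible h) :
    -e ∉ hyperbolicityCone h e := by
  intro hmem
  have := hmem (-1) ?_
  · linarith
  · rw [isRoot_restrict_iff]
    simpa using hyp.eval_zero_of_irreducible hirr

/-- One point outside the cone is enough, and `-e` is one: the common factor found near it is
associated to the irreducible `h`. -/
theorem AbstractLax.exists_dvd_detPoly (conj : AbstractLax h e) (hyp : IsHyperbolic h e)
    (hirr : Irreducible h) :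
    ∃ (k : ℕ) (L : (Fin n → ℝ) →ₗ[ℝ] Matrix (Fin k) (Fin k) ℝ),
      IsRelaxation (hyperbolicityCone h e) e L ∧ h ∣ detPoly L := by
  obtain ⟨k, L, hL, hev⟩ := conj.exists_relaxation (hyp.neg_notMem_of_irreducible hirr)
  obtain ⟨r, hr, hgen⟩ := exists_generic_common_factor e h (detPoly L) hirr.ne_zero
  obtain ⟨b, ⟨s, -, hs1, hs2⟩, hbr⟩ := exists_eval_ne_zero_of_eventually hr hev
  obtain ⟨q, hq, hqh, hqL, -⟩ := hgen b s hbr hs1 hs2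
  exact ⟨k, L, hL, (hq.dvd_symm hirr hqh).trans hqL⟩

/-- A factor of a homogeneous polynomial, complementary to a homogeneous one, is homogeneous. -/
theorem isHomogeneous_of_mul_left {f g : MvPolynomial (Fin n) ℝ} {d k : ℕ} (hg : g ≠ 0)
    (hgd : g.IsHomogeneous d) (hgf : (g * f).IsHomogeneous k) : ∃ l, f.IsHomogeneous l := by
  let := MvPolynomial.gradedAlgebra (σ := Fin n) (R := ℝ)
  -- If `k < d`, the subtraction truncates to `0`, but then every component of `f` vanishes and any
  -- degree is correct.
  refine ⟨k - d, ?_⟩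
  -- The degree `d + l` part of `g * f` is `g` times the degree `l` part of `f`.
  have key : ∀ l, d + l ≠ k → MvPolynomial.homogeneousComponent l f = 0 := by
    intro l hl
    have h1 := DirectSum.coe_decompose_mul_add_of_left_mem
      (MvPolynomial.homogeneousSubmodule (Fin n) ℝ) (j := l) (b := f) hgd
    have h2 := MvPolynomial.homogeneousComponent_of_mem (m := d + l) hgf
    rw [if_neg hl] at h2
    have hdec : ∀ (p : MvPolynomial (Fin n) ℝ) (j : ℕ), ((DirectSum.decompose
        (MvPolynomial.homogeneousSubmodule (Fin n) ℝ) p) j : MvPolynomial (Fin n) ℝ) =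
        MvPolynomial.homogeneousComponent j p := MvPolynomial.decomposition.decompose'_apply
    rw [hdec, hdec, h2] at h1
    exact (mul_eq_zero.1 h1.symm).resolve_left hg
  rw [← MvPolynomial.sum_homogeneousComponent f]
  refine MvPolynomial.IsHomogeneous.sum _ _ _ fun l _ => ?_
  by_cases hl : d + l = k
  · rw [← hl, Nat.add_sub_cancel_left]
    exact MvPolynomial.homogeneousComponent_isHomogeneous _ _
  · rw [key l hl]
    exact MvPolynomial.isHomogeneous_zero _ _ _

section Complexify

variable {k : ℕ} (L : (Fin n → ℝ) →ₗ[ℝ] Matrix (Fin k) (Fin k) ℝ)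

/-- The complex matrices representing a real linear matrix family. -/
noncomputable def complexCoeff (i : Fin n) : Matrix (Fin k) (Fin k) ℂ :=
  (L (Pi.single i 1)).map (algebraMap ℝ ℂ)

theorem pencil_complexCoeff (a : Fin n → ℝ) :
    pencil (complexCoeff L) a = (L a).map (algebraMap ℝ ℂ) := by
  rw [linear_eq_sum L a]
  ext i j
  simp [pencil, complexCoeff, Matrix.sum_apply]

theorem isHermitian_map_ofReal {A : Matrix (Fin k) (Fin k) ℝ} (hA : A.IsHermitian) :
    (A.map (algebraMap ℝ ℂ)).IsHermitian :=
  hA.map _ fun x => by simp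

theorem det_map_sub_smul_one (A : Matrix (Fin k) (Fin k) ℝ) (t : ℝ) :
    (A.map (algebraMap ℝ ℂ) - (t : ℂ) • (1 : Matrix (Fin k) (Fin k) ℂ)).det =
      ((A - t • (1 : Matrix (Fin k) (Fin k) ℝ)).det : ℂ) := by
  rw [← Complex.coe_algebraMap, RingHom.map_det]
  congr 1
  ext i j
  by_cases hij : i = j <;> simp [hij]

theorem posSemidef_map_ofReal_iff {A : Matrix (Fin k) (Fin k) ℝ} (hA : A.IsHermitian) :
    (A.map (algebraMap ℝ ℂ)).PosSemidef ↔ A.PosSemidef := by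
  rw [isHermitian_eigenvalue_nonneg_iff (isHermitian_map_ofReal hA),
    isHermitian_eigenvalue_nonneg_iff hA]
  refine forall_congr' fun t => imp_congr_left ?_
  have := det_map_sub_smul_one A t
  rw [← Complex.ofReal_eq_zero]
  exact this ▸ Iff.rfl

theorem map_detPoly :
    MvPolynomial.map (algebraMap ℝ ℂ) (detPoly L) =
      (∑ i, (MvPolynomial.X i : MvPolynomial (Fin n) ℂ) •
        (complexCoeff L i).map MvPolynomial.C).det := by
  rw [detPoly, RingHom.map_det]
  congr 1
  ext i j
  simp [complexCoeff, Matrix.sum_apply]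

end Complexify

/-- A complex root of the determinant of a symmetric family is an eigenvalue, hence real. -/
theorem IsRelaxation.im_eq_zero_of_root {K : Set (Fin n → ℝ)} {k : ℕ}
    {L : (Fin n → ℝ) →ₗ[ℝ] Matrix (Fin k) (Fin k) ℝ} (hL : IsRelaxation K e L)
    (a : Fin n → ℝ) (z : ℂ) (hz : aeval z (restrict (detPoly L) e a) = 0) : z.im = 0 := by
  -- The sign compares `det (L a - t)` with the characteristic polynomial `det (t - L a)`.
  have hp : restrict (detPoly L) e a =
      (-1 : ℝ[X]) ^ k * (L a).charpoly := by
    refine Polynomial.funext fun t => ?_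
    rw [eval_restrict, eval_detPoly, map_sub, map_smul, hL.map_direction, eval_mul,
      eval_charpoly, eval_pow, eval_neg, eval_one, ← neg_sub, det_neg, Fintype.card_fin]
    congr 2
    rw [smul_one_eq_diagonal]
    rfl
  rw [hp, map_mul, map_pow, map_neg, map_one, mul_eq_zero] at hz
  have hz' := hz.resolve_left (pow_ne_zero _ (by simp))
  rw [(hL.isHermitian a).charpoly_eq, map_prod, Finset.prod_eq_zero_iff] at hz'
  obtain ⟨i, -, hi⟩ := hz'
  simp only [map_sub, aeval_X, aeval_C, sub_eq_zero] at hi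
  rw [hi]
  simp

/-! ### The two conclusions -/

theorem AbstractLax.isSpectrahedral (conj : AbstractLax h e) (hh : h ≠ 0) :
    IsSpectrahedral (hyperbolicityCone h e) := by
  obtain ⟨k, L, hL, hΛ, -⟩ := conj.exists_exact_relaxation hh
  refine ⟨k, complexCoeff L, fun i => isHermitian_map_ofReal (hL.isHermitian _), ?_⟩
  rw [hΛ]
  ext a
  rw [Set.mem_ofPred_eq, Set.mem_ofPred_eq, pencil_complexCoeff,
    posSemidef_map_ofReal_iff (hL.isHermitian a)]

/-- Universality lets the same `L` both define the cone exactly and have determinant divisible by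
`h`. The cofactor `f` inherits real roots from `det L`, and `f(e) ≠ 0` since `det (L e) = 1`. -/
theorem AbstractLax.hasDefiniteDetRepMultiple (conj : AbstractLax h e) (hyp : IsHyperbolic h e)
    (hirr : Irreducible h) : HasDefiniteDetRepMultiple h e := by
  obtain ⟨k, L, hL, hΛ, hLq⟩ := conj.exists_exact_relaxation hirr.ne_zero
  obtain ⟨k', L', hL', hdvd⟩ := conj.exists_dvd_detPoly hyp hirr
  obtain ⟨f, hf⟩ := hLq h hirr dvd_rfl k' L' hL' hdvd
  have hfh : f * h = detPoly L := by rw [hf, mul_comm]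
  obtain ⟨d, hd⟩ := hyp.homogeneous
  have hfe : MvPolynomial.eval e f ≠ 0 := by
    intro h0
    have h1 := eval_detPoly L e
    rw [hf, map_mul, h0, mul_zero, hL.map_direction, det_one] at h1
    exact zero_ne_one h1
  refine ⟨f, ⟨isHomogeneous_of_mul_left hirr.ne_zero hd (hf ▸ isHomogeneous_detPoly L), hfe,
    fun a z hz => hL.im_eq_zero_of_root a z ?_⟩, ?_, k, complexCoeff L,
    fun i => isHermitian_map_ofReal (hL.isHermitian _), ?_, Or.inl ?_⟩
  · rw [hf, restrict, map_mul, map_mul]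
    exact mul_eq_zero_of_right _ hz
  · rw [hfh, hL.hyperbolicityCone_eq, hΛ]
  · rw [hfh, map_detPoly]
  · rw [pencil_complexCoeff, hL.map_direction]
    simpa using PosDef.one

end Main

end HyperbolicClifford

theorem mainTheorem7 {n : ℕ} (h : MvPolynomial (Fin n) ℝ) (e : Fin n → ℝ)
    (hyp : HyperbolicClifford.IsHyperbolic h e) (h_ne_one : h ≠ 1)
    (conj : HyperbolicClifford.AbstractLax h e) :
    HyperbolicClifford.IsSpectrahedral (HyperbolicClifford.hyperbolicityCone h e) ∧
      (Irreducible h → HyperbolicClifford.HasDefiniteDetRepMultiple h e) :=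
  ⟨conj.isSpectrahedral fun h0 => hyp.eval_ne_zero (by rw [h0, map_zero]),
    conj.hasDefiniteDetRepMultiple hyp⟩
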